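/- **Weak Implicit Mapping Theorem.** Let $\mathfrak C_1,\mathfrak C_2$ be real Banach spaces compactly embedded in Banach spaces $\mathfrak B_1,\mathfrak B_2$ respectively, and let $\mathfrak C_3\subset\mathfrak B_3$ be Banach spaces with continuous inclusion. Let $(x_0,y_0)\in\mathfrak C_1\times\mathfrak C_2$, let $U$ be a neighborhood of $(x_0,y_0)$ in $\mathfrak B_1\times\mathfrak B_2$, and let $V\subset U$ be a neighborhood of $(x_0,y_0)$ in $\mathfrak C_1\times\mathfrak C_2$. Suppose that a mapping $\mathcal F$ satisfies the following. (i) $\mathcal F$ maps $U$ to $\mathfrak B_3$ and $V$ to $\mathfrak C_3$, and $\mathcal F(x_0,y_0)=0$. (ii) Whenever a sequence $\{(x_k,y_k)\}\subset V$ converges in $\mathfrak B_1\times\mathfrak B_2$ to a point $(x_*,y_*)\in U$, the sequence $\mathcal F(x_k,y_k)$ converges to $\mathcal F(x_*,y_*)$ in $\mathfrak B_3$. (iii) $\mathcal F$ is Fréchet differentiable at $(x_0,y_0)$, both as a mapping from $\mathfrak B_1\times\mathfrak B_2$ to $\mathfrak B_3$ and as a mapping from $\mathfrak C_1\times\mathfrak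 C_2$ to $\mathfrak C_3$. (iv) The partial Fréchet derivative $D_x\mathcal F(x_0,y_0)$ is invertible, both as a bounded linear operator from $\mathfrak B_1$ to $\mathfrak B_3$ and as a bounded linear operator from $\mathfrak C_1$ to $\mathfrak C_3$. Then there is a neighborhood $\mathcal U_2$ of $y_0$ in $\mathfrak C_2$ such that for every $y\in\mathcal U_2$ there is $x^*=x^*(y)\in\mathfrak B_1$ with $(x^*,y)\in U$ and $\mathcal F(x^*(y),y)=0$. If moreover the closed unit ball of $\mathfrak C_1$ is closed (hence compact) in $\mathfrak B_1$, then for every $y\in\mathcal U_2$ such an $x^*(y)$ can be chosen in $\mathfrak C_1$, with $(x^*(y),y)\in V$. -/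

import Mathlib

open Filter Topology

/-- A bounded linear map `i : C → B` between normed spaces realises `C` as a space compactly
embedded in `B`: it is injective and maps bounded sets to relatively compact sets. -/
def IsCompactEmbedding {C B : Type*} [NormedAddCommGroup C] [NormedSpace ℝ C]
    [NormedAddCommGroup B] [NormedSpace ℝ B] (i : C →L[ℝ] B) : Prop :=
  Function.Injective i ∧ IsCompactOperator i

/-!
The equation `F (x, y) = 0` is solved by a fixed point of `T x = x - A⁻¹ F (x, y)`, where `A` is the
partial derivative in `x` at the base point. Since `F` is differentiable at one point only, `T` need
not be a contraction. It does however map a small closed ball of `C₁` to itself when `y` is close to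
`y₀`: this is the first order expansion of `F` as a map into `C₃`
(`eventually_mapsTo_sub_symm_apply`). Here it matters that `A⁻¹` is the same operator on `B₃` and on
`C₃`, which follows from the uniqueness of derivatives.

The closure in `B₁` of the image of that ball is compact and convex. By the sequential continuity
of `F` along points of the ball, and by regularity of the target, `T` is continuous on this closure
(`continuousOn_closure_of_seq`), hence maps it to itself, and Schauder's theorem
(`exists_fixedPoint_of_isCompact_convex`) gives a fixed point. If the unit ball of `C₁` is closed in
`B₁`, nothing is added by taking the closure, and the fixed point lies in the ball.

Schauder's theorem is reduced by finite nets to Brouwer's theorem on the standard simplex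
(`exists_fixedPoint_stdSimplex`). The latter comes from Scarf's lemma (`exists_colorful_dominant`), a
parity argument about finitely many rankings of a finite set, which needs no triangulation: it is
applied to the integer points of a dilated simplex, ranked by their coordinates.
-/

/-! ### Scarf's combinatorial lemma -/

section Scarf

variable {T I L : Type*} [LinearOrder L]

/-- `Dominant r A J`: no point of `T` lies strictly above all of `A` with respect to every one of
the rankings `r i`, `i ∈ J`. A dominant pair with as many points as indices is called a cell. A
pair `(A, J)` is colorful for a coloring `c : T → I` if `c` maps `A` onto `J`. -/
def Dominant (r : I → T → L) (A : Finset T) (J : Finset I) : Prop :=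
  ∀ t, ∃ i ∈ J, ∀ a ∈ A, r i t ≤ r i a

lemma Dominant.mono {r : I → T → L} {A A' : Finset T} {J J' : Finset I}
    (h : Dominant r A J) (hA : A' ⊆ A) (hJ : J ⊆ J') : Dominant r A' J' := fun t => by
  obtain ⟨i, hi, h⟩ := h t
  exact ⟨i, hJ hi, fun a ha => h a (hA ha)⟩

lemma exists_argmin (r : I → T → L) {A : Finset T} (hA : A.Nonempty) :
    ∃ m : I → T, ∀ i, m i ∈ A ∧ ∀ a ∈ A, r i (m i) ≤ r i a := by
  choose m h using fun i => A.exists_min_image (r i) hA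
  exact ⟨m, h⟩

/-- In a dominant pair every point of `A` is the smallest one for some ranking in `J`. -/
lemma Dominant.surjOn_argmin {r : I → T → L} (hr : ∀ i, Function.Injective (r i))
    {A : Finset T} {J : Finset I} (h : Dominant r A J) {m : I → T}
    (hm : ∀ i, m i ∈ A ∧ ∀ a ∈ A, r i (m i) ≤ r i a) : Set.SurjOn m J A := fun a ha => by
  obtain ⟨i, hi, h⟩ := h a
  exact ⟨i, hi, hr i (((hm i).2 a ha).antisymm (h _ (hm i).1))⟩

variable [DecidableEq T] [DecidableEq I]

/-- `(A, J)` is a facet of `(A', J')`: either one point is removed from `A'`, or one index is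
added to `J'`. -/
def IsFacet (d p : Finset T × Finset I) : Prop :=
  (∃ x ∉ d.1, p = (insert x d.1, d.2)) ∨ ∃ k ∈ d.2, p = (d.1, d.2.erase k)

/-- The only cell containing a facet without points is the one given by the top point. -/
lemma existsUnique_cell_of_empty [Finite T] [Nonempty T] {r : I → T → L}
    (hr : ∀ i, Function.Injective (r i)) (i : I) :
    ∃! p : Finset T × Finset I, IsFacet (∅, {i}) p ∧ Dominant r p.1 p.2 := by
  obtain ⟨x, hx⟩ := Finite.exists_max (r i)
  refine ⟨({x}, {i}), ⟨Or.inl ⟨x, by simp, by simp⟩, fun t => ⟨i, by simp, by simpa using hx t⟩⟩, ?_⟩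
  rintro p ⟨⟨y, -, rfl⟩ | ⟨k, hk, rfl⟩, hp⟩
  · have : x = y := by
      obtain ⟨j, hj, h⟩ := hp x
      simp only [Finset.mem_singleton] at hj
      subst hj
      exact hr j ((h y (by simp)).antisymm (hx y))
    subst this
    simp
  · obtain rfl : k = i := by simpa using hk
    obtain ⟨j, hj, -⟩ := hp x
    simp at hj

/-- A facet with at least one point lies in exactly two cells: the two indices of `J` with the same
smallest point of `A` each give one. -/
lemma exists_two_cells [Finite T] {r : I → T → L} (hr : ∀ i, Function.Injective (r i))
    {A : Finset T} {J : Finset I} (hA : A.Nonempty) (hc : J.card = A.card + 1)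
    (hd : Dominant r A J) :
    ∃ p q : Finset T × Finset I, p ≠ q ∧
      ∀ s, (IsFacet (A, J) s ∧ Dominant r s.1 s.2) ↔ s = p ∨ s = q := by
  obtain ⟨m, hm⟩ := exists_argmin r hA
  obtain ⟨i, hi, j, hj, hij, hmij⟩ := Finset.exists_ne_map_eq_of_card_lt_of_maps_to
    (t := A) (f := m) (by omega : A.card < J.card) (fun i _ => (hm i).1)
  have hinj : ∀ k ∈ J, Set.InjOn m (J.erase k) → k = i ∨ k = j := by
    intro k hk h
    by_contra! hne
    exact hij (h (by simp [hi, hne.1.symm]) (by simp [hj, hne.2.symm]) hmij)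
  -- `M k` collects the points that prevent the pair `(A, J.erase k)` from being dominant.
  let M : I → T → Prop := fun k x => ∀ l ∈ J, l ≠ k → r l (m l) < r l x
  have hMdom : ∀ k, (∀ x, ¬ M k x) ↔ Dominant r A (J.erase k) := by
    intro k
    refine forall_congr' fun x => ?_
    simp only [M, not_forall, not_lt, Finset.mem_erase]
    constructor
    · rintro ⟨l, hl, hlk, h⟩
      exact ⟨l, ⟨hlk, hl⟩, fun a ha => h.trans ((hm l).2 a ha)⟩
    · rintro ⟨l, ⟨hlk, hl⟩, h⟩
      exact ⟨l, hl, hlk, h _ (hm l).1⟩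
  have hMle : ∀ k x, M k x → r k x ≤ r k (m k) := by
    intro k x hx
    obtain ⟨l, hl, h⟩ := hd x
    by_cases hlk : l = k
    · exact hlk ▸ h _ (hm l).1
    · exact absurd (hx l hl hlk) (h _ (hm l).1).not_gt
  have hMA : ∀ k x, (k = i ∨ k = j) → M k x → x ∉ A := by
    intro k x hk hx hxA
    have hxm : x = m k := hr k ((hMle k x hx).antisymm ((hm k).2 x hxA))
    rcases hk with rfl | rfl
    · exact (hx j hj hij.symm).ne (by rw [hxm, hmij])
    · exact (hx i hi hij).ne (by rw [hxm, hmij])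
  -- The cell attached to each of the two indices.
  have key : ∀ k ∈ J, (k = i ∨ k = j) → ∃ p : Finset T × Finset I,
      (IsFacet (A, J) p ∧ Dominant r p.1 p.2) ∧
      ((p = (A, J.erase k) ∧ ∀ x, ¬ M k x) ∨
        ∃ x, x ∉ A ∧ M k x ∧ (∀ y, M k y → r k y ≤ r k x) ∧ p = (insert x A, J)) := by
    intro k hk hkij
    by_cases h : ∀ x, ¬ M k x
    · exact ⟨_, ⟨Or.inr ⟨k, hk, rfl⟩, (hMdom k).1 h⟩, Or.inl ⟨rfl, h⟩⟩
    · push Not at h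
      obtain ⟨x, hx, hmax⟩ := Set.exists_max_image {x | M k x} (r k) (Set.toFinite _) h
      have hxA := hMA k x hkij hx
      refine ⟨_, ⟨Or.inl ⟨x, hxA, rfl⟩, fun t => ?_⟩, Or.inr ⟨x, hxA, hx, hmax, rfl⟩⟩
      by_contra! hcon
      simp only [Finset.mem_insert, exists_eq_or_imp] at hcon
      have ht : M k t := by
        intro l hl hlk
        rcases hcon l hl with h | ⟨a, ha, h⟩
        · exact (hx l hl hlk).trans h
        · exact ((hm l).2 a ha).trans_lt h
      rcases hcon k hk with h | ⟨a, ha, h⟩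
      · exact (hmax t ht).not_gt h
      · exact (hMle k t ht).not_gt (((hm k).2 a ha).trans_lt h)
  obtain ⟨p, hp, hp'⟩ := key i hi (Or.inl rfl)
  obtain ⟨q, hq, hq'⟩ := key j hj (Or.inr rfl)
  refine ⟨p, q, ?_, fun s => ⟨?_, ?_⟩⟩
  · rintro rfl
    rcases hp' with ⟨h1, h1'⟩ | ⟨x, hxA, hx, -, h1⟩ <;>
      rcases hq' with ⟨h2, h2'⟩ | ⟨y, hyA, hy, -, h2⟩
    · have := (Prod.ext_iff.1 (h1.symm.trans h2)).2
      have hmem : j ∈ J.erase i := by simp [hj, hij.symm]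
      simp only at this
      rw [this] at hmem
      simp at hmem
    · have := (Prod.ext_iff.1 (h1.symm.trans h2)).1
      simp only at this
      exact hyA (this ▸ Finset.mem_insert_self y A)
    · have := (Prod.ext_iff.1 (h1.symm.trans h2)).1
      simp only at this
      exact hxA (this ▸ Finset.mem_insert_self x A)
    · have h3 := (Prod.ext_iff.1 (h1.symm.trans h2)).1
      simp only at h3
      have hxy : x = y := by
        have : x ∈ insert y A := h3 ▸ Finset.mem_insert_self x A
        simpa [hxA] using this
      subst hxy
      obtain ⟨l, hl, h⟩ := hd x
      by_cases hli : l = i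
      · exact (hy l hl (hli ▸ hij)).not_ge (h _ (hm l).1)
      · exact (hx l hl hli).not_ge (h _ (hm l).1)
  · rintro ⟨⟨x, hxA, rfl⟩ | ⟨k, hk, rfl⟩, hs⟩
    · simp only at hxA hs
      obtain ⟨m', hm'⟩ := exists_argmin r (Finset.insert_nonempty x A)
      have hsurj := hs.surjOn_argmin hr hm'
      have hinj' : Set.InjOn m' J := Finset.injOn_of_surjOn_of_card_le m'
        (fun l _ => (hm' l).1) hsurj (by rw [Finset.card_insert_of_notMem hxA, hc])
      obtain ⟨k, hk, hkx⟩ := hsurj (by simp : x ∈ ((insert x A : Finset T) : Set T))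
      have hmm : ∀ l ∈ J, l ≠ k → m' l ≠ x ∧ m' l = m l := by
        intro l hl hlk
        have hne : m' l ≠ x := fun h => hlk (hinj' hl hk (h.trans hkx.symm))
        have hmem : m' l ∈ A := by simpa [hne] using (hm' l).1
        exact ⟨hne, hr l (((hm' l).2 _ (by simp [(hm l).1])).antisymm ((hm l).2 _ hmem))⟩
      have hkij := hinj k hk (by
        intro a ha b hb hab
        simp only [Finset.coe_erase, Set.mem_sdiff, Finset.mem_coe, Set.mem_singleton_iff] at ha hb
        exact hinj' ha.1 hb.1 (by rw [(hmm a ha.1 ha.2).2, (hmm b hb.1 hb.2).2, hab]))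
      have hxM : M k x := by
        intro l hl hlk
        obtain ⟨h1, h2⟩ := hmm l hl hlk
        refine lt_of_le_of_ne (h2 ▸ (hm' l).2 x (by simp)) fun h => h1 ?_
        rw [h2]; exact hr l h
      have hxmax : ∀ y, M k y → r k y ≤ r k x := by
        intro y hy
        obtain ⟨l, hl, h⟩ := hs y
        by_cases hlk : l = k
        · subst hlk; exact h x (by simp)
        · exact absurd (h (m l) (by simp [(hm l).1])) (hy l hl hlk).not_ge
      have aux : ∀ {p : Finset T × Finset I}, ((p = (A, J.erase k) ∧ ∀ x, ¬ M k x) ∨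
          ∃ x, x ∉ A ∧ M k x ∧ (∀ y, M k y → r k y ≤ r k x) ∧ p = (insert x A, J)) →
          (insert x A, J) = p := by
        rintro p (⟨-, h⟩ | ⟨y, -, hy, hymax, rfl⟩)
        · exact absurd hxM (h x)
        · rw [hr k ((hxmax y hy).antisymm (hymax x hxM))]
      rcases hkij with rfl | rfl
      · exact Or.inl (aux hp')
      · exact Or.inr (aux hq')
    · simp only at hk hs
      have hkij := hinj k hk (Finset.injOn_of_surjOn_of_card_le m (fun l _ => (hm l).1)
        (hs.surjOn_argmin hr hm) (by rw [Finset.card_erase_of_mem hk, hc]; simp))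
      have aux : ∀ {p : Finset T × Finset I}, ((p = (A, J.erase k) ∧ ∀ x, ¬ M k x) ∨
          ∃ x, x ∉ A ∧ M k x ∧ (∀ y, M k y → r k y ≤ r k x) ∧ p = (insert x A, J)) →
          (A, J.erase k) = p := by
        rintro p (⟨h, -⟩ | ⟨y, -, hy, -, rfl⟩)
        · exact h.symm
        · exact absurd hy ((hMdom k).2 hs y)
      rcases hkij with rfl | rfl
      · exact Or.inl (aux hp')
      · exact Or.inr (aux hq')
  · rintro (rfl | rfl)
    · exact hp
    · exact hq

/-- The `i₀`-typed facets of a coloring `c`: pairs `(A, J)` with one index more than points, such that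
the colors on `A` are those of `J` except `i₀`, each occurring once. -/
def IsTypedFacet (c : T → I) (i₀ : I) (d : Finset T × Finset I) : Prop :=
  d.2.card = d.1.card + 1 ∧ i₀ ∈ d.2 ∧ d.1.image c = d.2.erase i₀

/-- Removing the new point `x` gives a typed facet of the cell. The second one arises by removing the
other point of the same color, if there is one, and by adding the color of `x` to `J` otherwise. -/
lemma exists_two_typed_facets_of_insert {c : T → I} {i₀ : I} {A : Finset T} {J : Finset I} {x : T}
    (hx : x ∉ A) (hd : IsTypedFacet c i₀ (A, J)) (hcol : (insert x A).image c ≠ J) :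
    ∃ d e : Finset T × Finset I, d ≠ e ∧
      ∀ s, (IsTypedFacet c i₀ s ∧ IsFacet s (insert x A, J)) ↔ s = d ∨ s = e := by
  obtain ⟨hcard, hi₀, him⟩ := hd
  simp only at hcard hi₀ him
  have hcx : c x ≠ i₀ := by
    rintro h
    apply hcol
    rw [Finset.image_insert, him, h, Finset.insert_erase hi₀]
  have hinj : Set.InjOn c A := by
    rw [← Finset.card_image_iff, him, Finset.card_erase_of_mem hi₀, hcard]; simp
  by_cases hxJ : c x ∈ J
  · obtain ⟨z, hz, hzx⟩ : ∃ z ∈ A, c z = c x := by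
      rw [← Finset.mem_image, him]; simp [hxJ, hcx]
    have hzne : z ≠ x := fun h => hx (h ▸ hz)
    have himz : (insert x (A.erase z)).image c = J.erase i₀ := by
      rw [Finset.image_insert, ← hzx, ← Finset.image_insert, Finset.insert_erase hz, him]
    have hxz : x ∉ A.erase z := fun h => hx (Finset.mem_of_mem_erase h)
    refine ⟨(A, J), (insert x (A.erase z), J), ?_, fun s => ⟨?_, ?_⟩⟩
    · intro h
      have := (Prod.ext_iff.1 h).1
      simp only at this
      exact hx (this ▸ Finset.mem_insert_self _ _)
    · rintro ⟨⟨h1, h2, h3⟩, ⟨y, hy, h⟩ | ⟨k, hk, h⟩⟩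
      · obtain ⟨B, K⟩ := s
        simp only [Prod.mk.injEq] at h1 h2 h3 hy h
        obtain ⟨hB, rfl⟩ := h
        have hinjB : Set.InjOn c B := by
          rw [← Finset.card_image_iff, h3, Finset.card_erase_of_mem hi₀, h1]; simp
        have hBe : B = (insert x A).erase y := by rw [hB, Finset.erase_insert hy]
        have hyxz : y = x ∨ y = z := by
          by_contra! hne
          refine hzne (hinjB ?_ ?_ hzx)
          · simp [hBe, hne.2.symm, hz]
          · simp [hBe, hne.1.symm]
        rcases hyxz with rfl | rfl
        · left; rw [hBe, Finset.erase_insert hx]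
        · right; rw [hBe, Finset.erase_insert_of_ne hzne.symm]
      · obtain ⟨B, K⟩ := s
        simp only [Prod.mk.injEq] at h1 h2 h3 hk h
        obtain ⟨rfl, rfl⟩ := h
        exfalso
        have hkk : k ∉ K.erase k := by simp
        have hki : k ≠ i₀ := fun h => by simp [h] at hi₀
        have : k ∈ (insert x A).image c := by rw [h3]; simp [hki, hk]
        rw [Finset.image_insert, him] at this
        simp only [Finset.mem_insert, Finset.mem_erase] at this
        rcases this with h | h
        · exact hkk (h ▸ hxJ)
        · exact h.2.1 rfl
    · rintro (rfl | rfl)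
      · exact ⟨⟨hcard, hi₀, him⟩, Or.inl ⟨x, hx, rfl⟩⟩
      · refine ⟨⟨?_, hi₀, himz⟩, Or.inl ⟨z, by simp [hzne], ?_⟩⟩
        · simp only
          rw [Finset.card_insert_of_notMem hxz, Finset.card_erase_add_one hz, hcard]
        · simp only
          rw [Finset.insert_comm, Finset.insert_erase hz]
  · have hcxA : ∀ a ∈ A, c a ≠ c x := fun a ha h => by
      have : c a ∈ J.erase i₀ := him ▸ Finset.mem_image_of_mem c ha
      exact hxJ (h ▸ Finset.mem_of_mem_erase this)
    refine ⟨(A, J), (insert x A, insert (c x) J), ?_, fun s => ⟨?_, ?_⟩⟩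
    · intro h
      have := (Prod.ext_iff.1 h).1
      simp only at this
      exact hx (this ▸ Finset.mem_insert_self _ _)
    · rintro ⟨⟨h1, h2, h3⟩, ⟨y, hy, h⟩ | ⟨k, hk, h⟩⟩
      · obtain ⟨B, K⟩ := s
        simp only [Prod.mk.injEq] at h1 h2 h3 hy h
        obtain ⟨hB, rfl⟩ := h
        have hBe : B = (insert x A).erase y := by rw [hB, Finset.erase_insert hy]
        have hyx : y = x := by
          by_contra hne
          have : c x ∈ B.image c := Finset.mem_image_of_mem c (by simp [hBe, Ne.symm hne])
          rw [h3] at this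
          exact hxJ (Finset.mem_of_mem_erase this)
        subst hyx
        left; rw [hBe, Finset.erase_insert hx]
      · obtain ⟨B, K⟩ := s
        simp only [Prod.mk.injEq] at h1 h2 h3 hk h
        obtain ⟨rfl, rfl⟩ := h
        right
        have : c x ∈ (insert x A).image c := Finset.mem_image_of_mem c (by simp)
        rw [h3] at this
        have hk' : c x = k := by
          by_contra hne
          exact hxJ (by simp [hne, Finset.mem_of_mem_erase this])
        rw [hk', Finset.insert_erase hk]
    · rintro (rfl | rfl)
      · exact ⟨⟨hcard, hi₀, him⟩, Or.inl ⟨x, hx, rfl⟩⟩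
      · refine ⟨⟨?_, by simp [hi₀], ?_⟩, Or.inr ⟨c x, by simp, ?_⟩⟩
        · simp only
          rw [Finset.card_insert_of_notMem hxJ, Finset.card_insert_of_notMem hx, hcard]
        · simp only
          rw [Finset.image_insert, him, Finset.erase_insert_of_ne hcx]
        · simp only
          rw [Finset.erase_insert hxJ]

/-- A cell that is not colorful has no typed facet or exactly two. -/
lemma exists_two_typed_facets {c : T → I} {i₀ : I} {p d₀ : Finset T × Finset I}
    (hcol : p.1.image c ≠ p.2) (hd₀ : IsTypedFacet c i₀ d₀) (hf : IsFacet d₀ p) :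
    ∃ d e : Finset T × Finset I, d ≠ e ∧
      ∀ s, (IsTypedFacet c i₀ s ∧ IsFacet s p) ↔ s = d ∨ s = e := by
  obtain ⟨A, J⟩ := d₀
  rcases hf with ⟨x, hx, rfl⟩ | ⟨k, hk, rfl⟩
  · exact exists_two_typed_facets_of_insert hx hd₀ hcol
  · -- The point of color `k` can be removed, which leads back to a facet of the other kind.
    obtain ⟨h1, h2, h3⟩ := hd₀
    simp only at h1 h2 h3 hk hcol ⊢
    have hki : k ≠ i₀ := by rintro rfl; exact hcol h3
    obtain ⟨x, hx, rfl⟩ : ∃ x ∈ A, c x = k := by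
      rw [← Finset.mem_image, h3]; simp [hki, hk]
    have hinj : Set.InjOn c A := by
      rw [← Finset.card_image_iff, h3, Finset.card_erase_of_mem h2, h1]; simp
    have := exists_two_typed_facets_of_insert (c := c) (i₀ := i₀) (A := A.erase x)
      (J := J.erase (c x)) (x := x) (by simp) ⟨?_, by simp [h2, hki.symm], ?_⟩
      (by rwa [Finset.insert_erase hx])
    · rwa [Finset.insert_erase hx] at this
    · simp only
      have h4 := Finset.card_erase_add_one hx
      have h5 := Finset.card_erase_add_one hk
      omega
    · simp only
      rw [Finset.erase_right_comm, ← h3]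
      ext y
      simp only [Finset.mem_image, Finset.mem_erase]
      constructor
      · rintro ⟨a, ⟨ha, haA⟩, rfl⟩
        exact ⟨fun h => ha (hinj haA hx h), a, haA, rfl⟩
      · rintro ⟨hy, a, haA, rfl⟩
        exact ⟨a, ⟨fun h => hy (h ▸ rfl), haA⟩, rfl⟩

/-- **Scarf's lemma**: for every coloring of the finite set `T` by the indices of the rankings there
is a colorful dominant pair. The proof counts the incidences between cells and typed facets
modulo two: only the facet `(∅, {i₀})` lies in an odd number of cells. -/
theorem exists_colorful_dominant [Finite T] [Nonempty T] [Finite I] {r : I → T → L}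
    (hr : ∀ i, Function.Injective (r i)) (c : T → I) :
    ∃ (A : Finset T) (J : Finset I), J.Nonempty ∧ Dominant r A J ∧ A.image c = J := by
  classical
  have := Fintype.ofFinite T
  have := Fintype.ofFinite I
  obtain ⟨i₀⟩ : Nonempty I := ⟨c (Classical.arbitrary T)⟩
  by_contra! hno
  have hne : ∀ A J, Dominant r A J → J.Nonempty := fun A J h => by
    obtain ⟨i, hi, -⟩ := h (Classical.arbitrary T)
    exact ⟨i, hi⟩
  let D : Finset (Finset T × Finset I) :=
    Finset.univ.filter fun d => IsTypedFacet c i₀ d ∧ Dominant r d.1 d.2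
  let R : Finset (Finset T × Finset I) := Finset.univ.filter fun p => Dominant r p.1 p.2
  have hcount := Finset.sum_card_bipartiteAbove_eq_sum_card_bipartiteBelow
    (s := D) (t := R) IsFacet
  have htop : ((∅, {i₀}) : Finset T × Finset I) ∈ D := by
    simp only [D, Finset.mem_filter, Finset.mem_univ, true_and]
    exact ⟨⟨by simp, by simp, by simp⟩, fun t => ⟨i₀, by simp, by simp⟩⟩
  have hodd : Odd (∑ d ∈ D, (R.bipartiteAbove IsFacet d).card) := by
    rw [← Finset.add_sum_erase _ _ htop]
    have h1 : (R.bipartiteAbove IsFacet (∅, {i₀})).card = 1 := by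
      obtain ⟨p, hp, huniq⟩ := existsUnique_cell_of_empty hr i₀
      rw [Finset.card_eq_one]
      refine ⟨p, ?_⟩
      ext s
      simp only [Finset.bipartiteAbove, R, Finset.mem_filter, Finset.mem_univ, true_and,
        Finset.mem_singleton]
      exact ⟨fun h => huniq s ⟨h.2, h.1⟩, by rintro rfl; exact ⟨hp.2, hp.1⟩⟩
    rw [h1]
    refine Even.one_add (Finset.even_sum _ fun d hd => ?_)
    simp only [D, Finset.mem_erase, Finset.mem_filter, Finset.mem_univ, true_and] at hd
    obtain ⟨hd0, ⟨hc, hi, him⟩, hdom⟩ := hd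
    have hA : d.1.Nonempty := by
      by_contra hA
      rw [Finset.not_nonempty_iff_eq_empty] at hA
      rw [hA, Finset.image_empty] at him
      apply hd0
      have : d.2 = {i₀} := by rw [← Finset.insert_erase hi, ← him, insert_empty_eq]
      exact Prod.ext hA this
    obtain ⟨p, q, hpq, h⟩ := exists_two_cells hr hA hc hdom
    have : R.bipartiteAbove IsFacet d = {p, q} := by
      ext s
      simp only [Finset.bipartiteAbove, R, Finset.mem_filter, Finset.mem_univ, true_and,
        Finset.mem_insert, Finset.mem_singleton]
      rw [← h s, and_comm]
    rw [this, Finset.card_pair hpq]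
    exact even_two
  have heven : Even (∑ p ∈ R, (D.bipartiteBelow IsFacet p).card) := by
    refine Finset.even_sum _ fun p hp => ?_
    simp only [R, Finset.mem_filter, Finset.mem_univ, true_and] at hp
    rcases (D.bipartiteBelow IsFacet p).eq_empty_or_nonempty with h | ⟨d₀, hd₀⟩
    · simp [h]
    simp only [Finset.bipartiteBelow, D, Finset.mem_filter, Finset.mem_univ, true_and] at hd₀
    obtain ⟨d, e, hde, h⟩ := exists_two_typed_facets (hno p.1 p.2 (hne _ _ hp) hp) hd₀.1.1 hd₀.2
    have : D.bipartiteBelow IsFacet p = {d, e} := by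
      ext s
      simp only [Finset.bipartiteBelow, D, Finset.mem_filter, Finset.mem_univ, true_and,
        Finset.mem_insert, Finset.mem_singleton]
      rw [← h s]
      refine ⟨fun h => ⟨h.1.1, h.2⟩, fun h => ⟨⟨h.1, ?_⟩, h.2⟩⟩
      rcases h.2 with ⟨x, hx, rfl⟩ | ⟨k, hk, rfl⟩
      · exact hp.mono (Finset.subset_insert _ _) subset_rfl
      · exact hp.mono subset_rfl (Finset.erase_subset _ _)
    rw [this, Finset.card_pair hde]
    exact even_two
  rw [hcount] at hodd
  exact (Nat.not_even_iff_odd.2 hodd) heven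

end Scarf

/-! ### Brouwer's theorem on the standard simplex -/

section Brouwer

variable {ι : Type*} [Fintype ι]

instance finite_grid (n : ℕ) : Finite {v : ι → ℕ // ∑ i, v i = n} := by
  classical
  refine Set.Finite.subset (Finset.finite_toSet (Finset.piAntidiag Finset.univ n)) fun v hv => ?_
  have hv' : ∑ i, v i = n := hv
  simpa using hv'

/-- A coloring of the grid points of a dilated simplex has grid points that are close to each other
such that every color `i` occurs among them, or else their `i`-th coordinates are small. Here
`s i` is the point responsible for the color `i`. -/
lemma exists_close_grid_points [Nonempty ι] {n : ℕ}
    (c : {v : ι → ℕ // ∑ i, v i = n} → ι) :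
    ∃ s : ι → {v : ι → ℕ // ∑ i, v i = n},
      (∀ i j k, (s i).1 k ≤ (s j).1 k + Fintype.card ι) ∧
      ∀ i, c (s i) = i ∨ (s i).1 i ≤ Fintype.card ι := by
  classical
  have hne : Nonempty {v : ι → ℕ // ∑ i, v i = n} :=
    ⟨⟨Pi.single (Classical.arbitrary ι) n, by simp⟩⟩
  let e := Finite.equivFin {v : ι → ℕ // ∑ i, v i = n}
  -- The `i`-th ranking is by the `i`-th coordinate, with ties broken by `e`.
  let r : ι → {v : ι → ℕ // ∑ i, v i = n} → ℕ ×ₗ Fin (Nat.card {v : ι → ℕ // ∑ i, v i = n}) :=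
    fun i t => toLex (t.1 i, e t)
  have hr : ∀ i, Function.Injective (r i) := by
    intro i s t h
    exact e.injective (Prod.ext_iff.1 (toLex.injective h)).2
  have hlt : ∀ i s t, s.1 i < t.1 i → r i s < r i t := by
    intro i s t h
    exact Prod.Lex.toLex_lt_toLex.2 (Or.inl h)
  obtain ⟨A, J, ⟨j, hj⟩, hdom, himg⟩ := exists_colorful_dominant hr c
  have hA : A.Nonempty := by
    rw [← Finset.image_nonempty (f := c), himg]
    exact ⟨j, hj⟩
  obtain ⟨m, hm⟩ := exists_argmin r hA
  let μ : ι → ℕ := fun i => if i ∈ J then (m i).1 i else 0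
  have hμ : ∀ a ∈ A, ∀ i, μ i ≤ a.1 i := by
    intro a ha i
    simp only [μ]
    split_ifs
    · by_contra! h
      exact ((hm i).2 a ha).not_gt (hlt _ _ _ h)
    · exact Nat.zero_le _
  -- Otherwise a grid point would exceed all the minima of the coordinates in `J`.
  have hsum : n ≤ ∑ i, μ i + Fintype.card ι := by
    by_contra! h
    have hcard : ∑ i, (μ i + 1) = ∑ i, μ i + Fintype.card ι := by
      simp [Finset.sum_add_distrib]
    let t : ι → ℕ := fun i => (μ i + 1) + Pi.single (M := fun _ => ℕ) j (n - ∑ i, (μ i + 1)) i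
    have ht : ∑ i, t i = n := by
      simp only [t, Finset.sum_add_distrib (f := fun i => μ i + 1), Finset.sum_pi_single',
        Finset.mem_univ, if_true]
      omega
    obtain ⟨i, hi, h⟩ := hdom ⟨t, ht⟩
    refine (h _ (hm i).1).not_gt (hlt _ _ _ ?_)
    simp only [t, μ, if_pos hi]
    omega
  have hup : ∀ a ∈ A, ∀ i, a.1 i ≤ μ i + Fintype.card ι := by
    intro a ha i
    have h1 : ∑ k, a.1 k = n := a.2
    rw [← Finset.add_sum_erase _ _ (Finset.mem_univ i)] at h1 hsum
    have h2 : ∑ k ∈ Finset.univ.erase i, μ k ≤ ∑ k ∈ Finset.univ.erase i, a.1 k :=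
      Finset.sum_le_sum fun k _ => hμ a ha k
    omega
  have hs : ∀ i, ∃ a ∈ A, c a = i ∨ a.1 i ≤ Fintype.card ι := by
    intro i
    by_cases hi : i ∈ J
    · rw [← himg, Finset.mem_image] at hi
      obtain ⟨a, ha, h⟩ := hi
      exact ⟨a, ha, Or.inl h⟩
    · obtain ⟨a, ha⟩ := hA
      refine ⟨a, ha, Or.inr ?_⟩
      simpa [μ, hi] using hup a ha i
  choose s hsA hs using hs
  exact ⟨s, fun i j k => (hup _ (hsA i) k).trans (by have := hμ _ (hsA j) k; omega), hs⟩

/-- **Brouwer's fixed point theorem** on the standard simplex. A grid point is colored by a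
coordinate that `f` does not decrease; in the limit of fine grids no coordinate is decreased. -/
theorem exists_fixedPoint_stdSimplex [Nonempty ι] {f : (ι → ℝ) → ι → ℝ}
    (hf : ContinuousOn f (stdSimplex ℝ ι)) (hmaps : Set.MapsTo f (stdSimplex ℝ ι) (stdSimplex ℝ ι)) :
    ∃ x ∈ stdSimplex ℝ ι, f x = x := by
  suffices h : ∃ x ∈ stdSimplex ℝ ι, ∀ i, x i ≤ f x i by
    obtain ⟨x, hx, h⟩ := h
    refine ⟨x, hx, funext fun i => ?_⟩
    have := (Finset.sum_eq_sum_iff_of_le (s := Finset.univ) fun i _ => h i).1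
      (hx.2.trans (hmaps hx).2.symm)
    exact (this i (Finset.mem_univ i)).symm
  let g : (n : ℕ) → {v : ι → ℕ // ∑ i, v i = n + 1} → ι → ℝ := fun n v i => v.1 i / ((n : ℝ) + 1)
  have hpos : ∀ n : ℕ, (0 : ℝ) < n + 1 := fun n => by positivity
  have hg : ∀ n v, g n v ∈ stdSimplex ℝ ι := by
    intro n v
    refine ⟨fun i => div_nonneg (Nat.cast_nonneg _) (hpos n).le, ?_⟩
    simp only [g]
    rw [← Finset.sum_div, ← Nat.cast_sum, v.2, Nat.cast_succ, div_self (hpos n).ne']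
  have hc : ∀ n v, ∃ i, g n v i ≤ f (g n v) i := by
    intro n v
    obtain ⟨i, -, h⟩ := Finset.exists_le_of_sum_le Finset.univ_nonempty
      ((hg n v).2.trans (hmaps (hg n v)).2.symm).le
    exact ⟨i, h⟩
  choose c hc using hc
  choose s hclose hs using fun n => exists_close_grid_points (c n)
  let N : ℝ := Fintype.card ι
  let i₀ : ι := Classical.arbitrary ι
  obtain ⟨x, hx, φ, hφ, hlim⟩ := (isCompact_stdSimplex ℝ ι).tendsto_subseq
    (fun n => hg n (s n i₀))
  have hε : Tendsto (fun n => N / ((φ n : ℝ) + 1)) atTop (𝓝 0) := by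
    have := (tendsto_one_div_add_atTop_nhds_zero_nat (𝕜 := ℝ)).comp hφ.tendsto_atTop
    simpa [Function.comp_def, div_eq_mul_inv] using this.const_mul N
  have hle : ∀ n i j k, g n (s n i) k ≤ g n (s n j) k + N / ((n : ℝ) + 1) := by
    intro n i j k
    simp only [g, N]
    rw [← add_div]
    exact div_le_div_of_nonneg_right (mod_cast hclose n i j k) (hpos n).le
  have hlim' : ∀ i, Tendsto (fun n => g (φ n) (s (φ n) i)) atTop (𝓝 x) := by
    intro i
    rw [tendsto_pi_nhds]
    intro k
    have hk := tendsto_pi_nhds.1 hlim k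
    refine tendsto_of_tendsto_of_tendsto_of_le_of_le (by simpa using hk.sub hε)
      (by simpa using hk.add hε) (fun n => ?_) (fun n => ?_)
    · have := hle (φ n) i₀ i k
      simp only
      linarith
    · exact hle (φ n) i i₀ k
  refine ⟨x, hx, fun i => ?_⟩
  have hfl : Tendsto (fun n => f (g (φ n) (s (φ n) i))) atTop (𝓝 (f x)) :=
    (hf x hx).tendsto.comp (tendsto_nhdsWithin_iff.2 ⟨hlim' i, Eventually.of_forall fun n => hg _ _⟩)
  refine le_of_tendsto_of_tendsto' (tendsto_pi_nhds.1 (hlim' i) i)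
    (by simpa using (tendsto_pi_nhds.1 hfl i).add hε) fun n => ?_
  have hN : 0 ≤ N / ((φ n : ℝ) + 1) := div_nonneg (Nat.cast_nonneg _) (hpos _).le
  rcases hs (φ n) i with h | h
  · have := hc (φ n) (s (φ n) i)
    rw [h] at this
    linarith
  · have h1 := (hmaps (hg (φ n) (s (φ n) i))).1 i
    have h2 : g (φ n) (s (φ n) i) i ≤ N / ((φ n : ℝ) + 1) :=
      div_le_div_of_nonneg_right (Nat.cast_le.2 h) (hpos _).le
    linarith

end Brouwer

/-! ### Schauder's theorem -/

section Schauder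

variable {E : Type*} [NormedAddCommGroup E] [NormedSpace ℝ E]

/-- A continuous self-map of a compact convex set moves some point by at most `ε`: project onto the
convex hull of a finite `ε`-net with Schauder's weights `max (ε - dist x a) 0` and use Brouwer's
theorem for the barycentric coordinates. -/
lemma exists_dist_self_le {K : Set E} (hK : IsCompact K) (hconv : Convex ℝ K) (hne : K.Nonempty)
    {f : E → E} (hf : ContinuousOn f K) (hmaps : Set.MapsTo f K K) {ε : ℝ} (hε : 0 < ε) :
    ∃ x ∈ K, dist (f x) x ≤ ε := by
  obtain ⟨t, htK, htfin, hcover⟩ := hK.finite_cover_balls hε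
  have := htfin.fintype
  have hnet : ∀ x ∈ K, ∃ a : t, dist x a < ε := by
    intro x hx
    obtain ⟨a, ha, h⟩ := Set.mem_iUnion₂.1 (hcover hx)
    exact ⟨⟨a, ha⟩, h⟩
  have : Nonempty t := by
    obtain ⟨x, hx⟩ := hne
    exact ⟨(hnet x hx).choose⟩
  let w : t → E → ℝ := fun a x => max (ε - dist x a) 0
  have hw : ∀ a x, 0 ≤ w a x := fun a x => le_max_right _ _
  have hW : ∀ x ∈ K, 0 < ∑ a, w a x := by
    intro x hx
    obtain ⟨a, ha⟩ := hnet x hx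
    exact Finset.sum_pos' (fun a _ => hw a x)
      ⟨a, Finset.mem_univ a, lt_max_of_lt_left (sub_pos.2 ha)⟩
  have hwc : ∀ a, Continuous (w a) := fun a => by fun_prop
  let p : (t → ℝ) → E := fun u => ∑ a, u a • (a : E)
  have hpc : Continuous p := by fun_prop
  have hpK : Set.MapsTo p (stdSimplex ℝ t) K := fun u hu =>
    hconv.sum_mem (fun a _ => hu.1 a) hu.2 fun a _ => htK a.2
  have hfp : ContinuousOn (fun u => f (p u)) (stdSimplex ℝ t) := hf.comp hpc.continuousOn hpK
  obtain ⟨u, hu, hfix⟩ := exists_fixedPoint_stdSimplex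
    (f := fun u a => w a (f (p u)) / ∑ b, w b (f (p u)))
    (continuousOn_pi.2 fun a => ((hwc a).comp_continuousOn hfp).div
      (continuousOn_finsetSum _ fun b _ => (hwc b).comp_continuousOn hfp)
      fun u hu => (hW _ (hmaps (hpK hu))).ne')
    (fun u hu => ⟨fun a => div_nonneg (hw _ _) (hW _ (hmaps (hpK hu))).le, by
      rw [← Finset.sum_div, div_self (hW _ (hmaps (hpK hu))).ne']⟩)
  refine ⟨p u, hpK hu, ?_⟩
  have hterm : ∀ a, ‖u a • ((a : E) - f (p u))‖ ≤ u a * ε := by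
    intro a
    rw [norm_smul, Real.norm_of_nonneg (hu.1 a)]
    rcases (hu.1 a).eq_or_lt with h | h
    · rw [← h]; simp
    · refine mul_le_mul_of_nonneg_left ?_ h.le
      by_contra! hcon
      -- Far from `a` the weight of `a` vanishes.
      have h0 : w a (f (p u)) = 0 := max_eq_right (by rw [dist_comm, dist_eq_norm]; linarith)
      have := congrFun hfix a
      simp only [h0, zero_div] at this
      exact h.ne this
  have hsum : p u - f (p u) = ∑ a, u a • ((a : E) - f (p u)) := by
    simp only [smul_sub, Finset.sum_sub_distrib, ← Finset.sum_smul, hu.2, one_smul, p]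
  rw [dist_comm, dist_eq_norm, hsum]
  calc _ ≤ ∑ a, u a * ε := norm_sum_le_of_le _ fun a _ => hterm a
    _ = ε := by rw [← Finset.sum_mul, hu.2, one_mul]

/-- **Schauder's fixed point theorem**. -/
theorem exists_fixedPoint_of_isCompact_convex {K : Set E} (hK : IsCompact K) (hconv : Convex ℝ K)
    (hne : K.Nonempty) {f : E → E} (hf : ContinuousOn f K) (hmaps : Set.MapsTo f K K) :
    ∃ x ∈ K, f x = x := by
  obtain ⟨x, hx, hmin⟩ := hK.exists_isMinOn hne (f := fun x => dist (f x) x)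
    (continuous_dist.comp_continuousOn (hf.prodMk continuousOn_id))
  refine ⟨x, hx, dist_le_zero.1 (le_of_forall_pos_le_add fun ε hε => ?_)⟩
  obtain ⟨y, hy, h⟩ := exists_dist_self_le hK hconv hne hf hmaps hε
  rw [zero_add]
  exact (hmin hy).trans h

end Schauder

/-! ### The ball invariant under the quasi-Newton map -/

/-- If the partial derivative `A` of `G` in the first variable is invertible at a zero `(x₀, y₀)`
of `G`, then for all small `r` the map `x ↦ x - A⁻¹ G (x, y)` maps the closed ball of radius `r`
about `x₀` to itself, as soon as `y` is close to `y₀`. Differentiability at the single point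
`(x₀, y₀)` suffices, but the map need not be a contraction. -/
lemma eventually_mapsTo_sub_symm_apply {X Y Z : Type*}
    [NormedAddCommGroup X] [NormedSpace ℝ X] [NormedAddCommGroup Y] [NormedSpace ℝ Y]
    [NormedAddCommGroup Z] [NormedSpace ℝ Z] {G : X × Y → Z} {x₀ : X} {y₀ : Y}
    {G' : X × Y →L[ℝ] Z} (hG : HasFDerivAt G G' (x₀, y₀)) (h0 : G (x₀, y₀) = 0)
    (A : X ≃L[ℝ] Z) (hA : ∀ x, A x = G' (x, 0)) :
    ∀ᶠ r in 𝓝[>] (0 : ℝ), ∀ᶠ y in 𝓝 y₀, Set.MapsTo (fun x => x - A.symm (G (x, y)))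
      (Metric.closedBall x₀ r) (Metric.closedBall x₀ r) := by
  set M : ℝ := ‖(A.symm : Z →L[ℝ] X)‖ with hM
  have hM0 : 0 ≤ M := norm_nonneg _
  have hη : (0 : ℝ) < 1 / (2 * (M + 1)) := by positivity
  obtain ⟨ρ, hρ, hball⟩ := Metric.eventually_nhds_iff.1 ((hasFDerivAt_iff_isLittleO.1 hG).def hη)
  filter_upwards [Ioo_mem_nhdsGT hρ] with r ⟨hr, hrρ⟩
  have hδ : 0 < r / (2 * (M + 1) * (‖G'‖ + 1)) := by positivity
  filter_upwards [Metric.closedBall_mem_nhds y₀ hr, Metric.closedBall_mem_nhds y₀ hδ]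
    with y hy hyδ x hx
  rw [mem_closedBall_iff_norm] at hx hy hyδ ⊢
  have hxy : ‖(x, y) - (x₀, y₀)‖ ≤ r := by
    rw [Prod.mk_sub_mk, Prod.norm_mk]; exact max_le hx hy
  have hR := hball (y := (x, y)) (by rw [dist_eq_norm]; exact hxy.trans_lt hrρ)
  rw [h0, sub_zero] at hR
  set R : Z := G (x, y) - G' ((x, y) - (x₀, y₀)) with hRdef
  have hsplit : G (x, y) = A (x - x₀) + (G' (0, y - y₀) + R) := by
    rw [hA, ← add_assoc, ← map_add, hRdef]
    simp
  have hGy : ‖G' (0, y - y₀)‖ ≤ ‖G'‖ * ‖y - y₀‖ := by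
    simpa [Prod.norm_mk] using G'.le_opNorm (0, y - y₀)
  have heq : x - A.symm (G (x, y)) - x₀ = -(A.symm (G' (0, y - y₀) + R)) := by
    rw [hsplit, map_add, A.symm_apply_apply]
    abel
  rw [heq, norm_neg]
  have h1 : ‖G'‖ * ‖y - y₀‖ ≤ r / (2 * (M + 1)) := by
    calc ‖G'‖ * ‖y - y₀‖ ≤ (‖G'‖ + 1) * (r / (2 * (M + 1) * (‖G'‖ + 1))) := by
          gcongr; linarith
      _ = r / (2 * (M + 1)) := by field_simp
  have h2 : ‖R‖ ≤ r / (2 * (M + 1)) := by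
    calc ‖R‖ ≤ 1 / (2 * (M + 1)) * r := hR.trans (by gcongr)
      _ = r / (2 * (M + 1)) := by ring
  calc ‖A.symm (G' (0, y - y₀) + R)‖
      ≤ M * ‖G' (0, y - y₀) + R‖ := (A.symm : Z →L[ℝ] X).le_opNorm _
    _ ≤ (M + 1) * (r / (2 * (M + 1)) + r / (2 * (M + 1))) := by
        gcongr
        · linarith
        · exact (norm_add_le _ _).trans (add_le_add (hGy.trans h1) h2)
    _ = r := by field_simp; ring

/-- If the image of the closed unit ball is closed, so is that of every closed ball. -/
lemma isClosed_image_closedBall {C B : Type*} [NormedAddCommGroup C] [NormedSpace ℝ C]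
    [NormedAddCommGroup B] [NormedSpace ℝ B] (i : C →L[ℝ] B)
    (h : IsClosed (i '' Metric.closedBall (0 : C) 1)) (x₀ : C) {r : ℝ} (hr : 0 < r) :
    IsClosed (i '' Metric.closedBall x₀ r) := by
  have : i '' Metric.closedBall x₀ r =
      (fun v => r⁻¹ • (v - i x₀)) ⁻¹' (i '' Metric.closedBall (0 : C) 1) := by
    ext v
    constructor
    · rintro ⟨c, hc, rfl⟩
      refine ⟨r⁻¹ • (c - x₀), ?_, by simp⟩
      rw [mem_closedBall_iff_norm] at hc
      rw [mem_closedBall_zero_iff, norm_smul, norm_inv, Real.norm_of_nonneg hr.le]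
      exact inv_mul_le_one_of_le₀ hc hr.le
    · rintro ⟨c, hc, h⟩
      rw [mem_closedBall_zero_iff] at hc
      refine ⟨x₀ + r • c, ?_, ?_⟩
      · rw [mem_closedBall_iff_norm, add_sub_cancel_left, norm_smul, Real.norm_of_nonneg hr.le]
        exact mul_le_of_le_one_right hr.le hc
      · rw [map_add, map_smul, h, smul_inv_smul₀ hr.ne', add_sub_cancel]
  rw [this]
  exact h.preimage (by fun_prop)

/-- A function with `g (u k) → g q` for all sequences in `S` that converge to a point `q` of the
closure of `S` is continuous on the closure, also along sequences that leave `S`. -/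
lemma continuousOn_closure_of_seq {X Y : Type*} [TopologicalSpace X] [FirstCountableTopology X]
    [TopologicalSpace Y] [T3Space Y] {g : X → Y} {S : Set X}
    (h : ∀ q ∈ closure S, ∀ u : ℕ → X, (∀ k, u k ∈ S) → Tendsto u atTop (𝓝 q) →
      Tendsto (fun k => g (u k)) atTop (𝓝 (g q))) : ContinuousOn g (closure S) := by
  have hlim : ∀ q ∈ closure S, Tendsto g (𝓝[S] q) (𝓝 (g q)) := by
    intro q hq
    refine tendsto_of_seq_tendsto fun u hu => ?_
    obtain ⟨hu, hmem⟩ := tendsto_nhdsWithin_iff.1 hu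
    obtain ⟨N, hN⟩ := eventually_atTop.1 hmem
    exact (tendsto_add_atTop_iff_nat N).1 (h q hq (fun k => u (k + N)) (fun k => hN _ (by omega))
      ((tendsto_add_atTop_iff_nat N).2 hu))
  exact (continuousOn_extendFrom subset_rfl fun q hq => ⟨_, hlim q hq⟩).congr
    fun q hq => (extendFrom_eq hq (hlim q hq)).symm

/-! ### The weak implicit mapping theorem -/

/-- `i₁`, `i₂`, `j` are the inclusions of `C₁`, `C₂`, `C₃` in `B₁`, `B₂`, `B₃`. The mapping is `F`,
defined on the neighbourhood `U` in `B₁ × B₂`; `FC` is the same mapping, viewed on the neighbourhood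
`V` in `C₁ × C₂` with values in `C₃`. Values of `F` off `U` and of `FC` off `V` play no role. -/
theorem mainTheorem4
    {B₁ B₂ B₃ C₁ C₂ C₃ : Type*}
    [NormedAddCommGroup B₁] [NormedSpace ℝ B₁] [CompleteSpace B₁]
    [NormedAddCommGroup B₂] [NormedSpace ℝ B₂] [CompleteSpace B₂]
    [NormedAddCommGroup B₃] [NormedSpace ℝ B₃] [CompleteSpace B₃]
    [NormedAddCommGroup C₁] [NormedSpace ℝ C₁] [CompleteSpace C₁]
    [NormedAddCommGroup C₂] [NormedSpace ℝ C₂] [CompleteSpace C₂]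
    [NormedAddCommGroup C₃] [NormedSpace ℝ C₃] [CompleteSpace C₃]
    (i₁ : C₁ →L[ℝ] B₁) (i₂ : C₂ →L[ℝ] B₂) (j : C₃ →L[ℝ] B₃)
    (hi₁ : IsCompactEmbedding i₁) (hi₂ : IsCompactEmbedding i₂) (hj : Function.Injective j)
    (x₀ : C₁) (y₀ : C₂)
    (U : Set (B₁ × B₂)) (hU : U ∈ 𝓝 (i₁ x₀, i₂ y₀))
    (V : Set (C₁ × C₂)) (hV : V ∈ 𝓝 (x₀, y₀))
    (hVU : ∀ p ∈ V, (i₁ p.1, i₂ p.2) ∈ U)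
    (F : B₁ × B₂ → B₃) (FC : C₁ × C₂ → C₃)
    (hFC : ∀ p ∈ V, j (FC p) = F (i₁ p.1, i₂ p.2))
    (hzero : F (i₁ x₀, i₂ y₀) = 0)
    (hcont : ∀ p : ℕ → C₁ × C₂, (∀ k, p k ∈ V) → ∀ q ∈ U,
      Tendsto (fun k => (i₁ (p k).1, i₂ (p k).2)) atTop (𝓝 q) →
        Tendsto (fun k => F (i₁ (p k).1, i₂ (p k).2)) atTop (𝓝 (F q)))
    (hdiffB : DifferentiableAt ℝ F (i₁ x₀, i₂ y₀))
    (hdiffC : DifferentiableAt ℝ FC (x₀, y₀))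
    (hinvB : (fderiv ℝ (fun x : B₁ => F (x, i₂ y₀)) (i₁ x₀)).IsInvertible)
    (hinvC : (fderiv ℝ (fun x : C₁ => FC (x, y₀)) x₀).IsInvertible) :
    ∃ U₂ ∈ 𝓝 y₀, ∀ y ∈ U₂,
      (∃ x : B₁, (x, i₂ y) ∈ U ∧ F (x, i₂ y) = 0) ∧
      (IsClosed (i₁ '' Metric.closedBall (0 : C₁) 1) →
        ∃ x : C₁, (x, y) ∈ V ∧ F (i₁ x, i₂ y) = 0) := by
  obtain ⟨AB, hAB⟩ := hinvB
  obtain ⟨AC, hAC⟩ := hinvC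
  have hFB : HasFDerivAt (fun x : B₁ => F (x, i₂ y₀)) (AB : B₁ →L[ℝ] B₃) (i₁ x₀) := by
    rw [hAB]
    exact (DifferentiableAt.comp (g := F) (f := fun x : B₁ => (x, i₂ y₀)) (i₁ x₀) hdiffB
      (by fun_prop)).hasFDerivAt
  have hFC' : HasFDerivAt (fun x : C₁ => FC (x, y₀)) (AC : C₁ →L[ℝ] C₃) x₀ := by
    rw [hAC]
    exact (DifferentiableAt.comp (g := FC) (f := fun x : C₁ => (x, y₀)) x₀ hdiffC
      (by fun_prop)).hasFDerivAt
  have hVx : ∀ᶠ x in 𝓝 x₀, (x, y₀) ∈ V :=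
    (Continuous.prodMk_left y₀).continuousAt.preimage_mem_nhds hV
  -- The two partial derivatives agree on `C₁`, and so do their inverses on `C₃`.
  have hcompat : ∀ x, j (AC x) = AB (i₁ x) := by
    have h1 : HasFDerivAt (fun x : C₁ => j (FC (x, y₀))) (j.comp (AC : C₁ →L[ℝ] C₃)) x₀ :=
      j.hasFDerivAt.comp x₀ hFC'
    have h2 : HasFDerivAt (fun x : C₁ => F (i₁ x, i₂ y₀)) ((AB : B₁ →L[ℝ] B₃).comp i₁) x₀ :=
      hFB.comp (f := i₁) x₀ i₁.hasFDerivAt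
    have h3 := h1.congr_of_eventuallyEq (f₁ := fun x : C₁ => F (i₁ x, i₂ y₀))
      (hVx.mono fun x hx => (hFC _ hx).symm)
    exact fun x => DFunLike.congr_fun (h3.unique h2) x
  have hsymm : ∀ z, AB.symm (j z) = i₁ (AC.symm z) := by
    intro z
    rw [AB.symm_apply_eq, ← hcompat, AC.apply_symm_apply]
  have hFC0 : FC (x₀, y₀) = 0 := hj (by rw [hFC _ (mem_of_mem_nhds hV), hzero, map_zero])
  have hA : ∀ x, AC x = fderiv ℝ FC (x₀, y₀) (x, 0) := by
    have h1 : HasFDerivAt (fun x : C₁ => FC (x, y₀))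
        ((fderiv ℝ FC (x₀, y₀)).comp (ContinuousLinearMap.inl ℝ C₁ C₂)) x₀ :=
      HasFDerivAt.comp (g := FC) x₀ hdiffC.hasFDerivAt (hasFDerivAt_prodMk_left x₀ y₀)
    exact fun x => DFunLike.congr_fun (hFC'.unique h1) x
  obtain ⟨ρ, hρ, hρU⟩ := Metric.nhds_basis_closedBall.mem_iff.1 hU
  obtain ⟨σ, hσ, hσV⟩ := Metric.nhds_basis_closedBall.mem_iff.1 hV
  -- A radius that keeps the ball in `V` and the closure of its image in `U`.
  obtain ⟨r, hself, hr, hrσ, hrρ⟩ : ∃ r, (∀ᶠ y in 𝓝 y₀,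
      Set.MapsTo (fun x => x - AC.symm (FC (x, y)))
        (Metric.closedBall x₀ r) (Metric.closedBall x₀ r)) ∧
      0 < r ∧ r ≤ σ ∧ ‖i₁‖ * r ≤ ρ := by
    have h1 : ∀ᶠ r in 𝓝[>] (0 : ℝ), ‖i₁‖ * r ≤ ρ := by
      have : Tendsto (fun r : ℝ => ‖i₁‖ * r) (𝓝[>] 0) (𝓝 0) := by
        have : ContinuousAt (fun r : ℝ => ‖i₁‖ * r) 0 := by fun_prop
        simpa using this.tendsto.mono_left nhdsWithin_le_nhds
      exact (this.eventually (gt_mem_nhds hρ)).mono fun _ h => le_of_lt h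
    obtain ⟨r, h2, h3, h4⟩ := ((eventually_mapsTo_sub_symm_apply hdiffC.hasFDerivAt hFC0 AC hA).and
      (h1.and (Ioo_mem_nhdsGT hσ))).exists
    exact ⟨r, h2, h4.1, h4.2.le, h3⟩
  have hi₂y : ∀ᶠ y in 𝓝 y₀, i₂ y ∈ Metric.closedBall (i₂ y₀) ρ :=
    i₂.continuous.continuousAt.preimage_mem_nhds (Metric.closedBall_mem_nhds _ hρ)
  refine ⟨_, hself.and (hi₂y.and (Metric.closedBall_mem_nhds y₀ hσ)), ?_⟩
  rintro y ⟨hy, hyρ, hyσ⟩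
  set S : Set B₁ := i₁ '' Metric.closedBall x₀ r with hS
  have hSV : ∀ x ∈ Metric.closedBall x₀ r, (x, y) ∈ V := fun x hx =>
    hσV (by
      rw [← closedBall_prod_same]
      exact ⟨Metric.closedBall_subset_closedBall hrσ hx, hyσ⟩)
  have hSU : ∀ q ∈ closure S, (q, i₂ y) ∈ U := by
    have hsub : closure S ⊆ Metric.closedBall (i₁ x₀) ρ := by
      refine closure_minimal ?_ Metric.isClosed_closedBall
      rintro _ ⟨x, hx, rfl⟩
      rw [mem_closedBall_iff_norm] at hx ⊢
      rw [← map_sub]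
      exact (i₁.le_opNorm _).trans ((mul_le_mul_of_nonneg_left hx (norm_nonneg _)).trans hrρ)
    intro q hq
    apply hρU
    rw [← closedBall_prod_same]
    exact ⟨hsub hq, hyρ⟩
  have hcompact : IsCompact (closure S) :=
    IsCompactOperator.isCompact_closure_image_of_bounded (f := (i₁ : C₁ →ₗ[ℝ] B₁)) hi₁.2
      Metric.isBounded_closedBall
  have hconv : Convex ℝ (closure S) :=
    ((convex_closedBall x₀ r).linear_image (i₁ : C₁ →ₗ[ℝ] B₁)).closure
  have hnonempty : (closure S).Nonempty :=
    ⟨i₁ x₀, subset_closure ⟨x₀, Metric.mem_closedBall_self hr.le, rfl⟩⟩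
  have hFcont : ContinuousOn (fun q => F (q, i₂ y)) (closure S) := by
    refine continuousOn_closure_of_seq fun q hq u hu hlim => ?_
    choose x hx hxu using hu
    have := hcont (fun k => (x k, y)) (fun k => hSV _ (hx k)) (q, i₂ y) (hSU q hq)
    simp only [hxu] at this
    exact this (hlim.prodMk_nhds tendsto_const_nhds)
  have hTcont : ContinuousOn (fun q => q - AB.symm (F (q, i₂ y))) (closure S) :=
    continuousOn_id.sub (AB.symm.continuous.comp_continuousOn hFcont)
  have hTS : Set.MapsTo (fun q => q - AB.symm (F (q, i₂ y))) S S := by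
    rintro _ ⟨x, hx, rfl⟩
    refine ⟨_, hy hx, ?_⟩
    simp only
    rw [map_sub, ← hsymm, hFC _ (hSV x hx)]
  obtain ⟨q, hq, hfix⟩ := exists_fixedPoint_of_isCompact_convex hcompact hconv hnonempty hTcont
    (hTS.closure_of_continuousOn hTcont)
  have hFq : F (q, i₂ y) = 0 := by
    rw [sub_eq_self] at hfix
    simpa using hfix
  refine ⟨⟨q, hSU q hq, hFq⟩, fun hclosed => ?_⟩
  rw [(isClosed_image_closedBall i₁ hclosed x₀ hr).closure_eq] at hq
  obtain ⟨x, hx, rfl⟩ := hq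
  exact ⟨x, hSV x hx, hFq⟩
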